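/- Let $p\ge 0$ be an integer, let $(\Omega,\mathcal F,P)$ be a probability space and let $u_n:\mathbb R^p\to\mathbb R^p$, $n\ge 1$, be random functions on it (estimating functions), i.e. $u_n(\theta)$ is a random vector for each $\theta\in\mathbb R^p$, such that $\theta\mapsto u_n(\theta)$ is differentiable. Put $J_n(\theta)=-\frac{\mathrm d}{\mathrm d\theta}u_n(\theta)$, the $p\times p$ matrix with entries $-\partial (u_n)_i/\partial\theta_j$. Let $\|\cdot\|$ denote the Euclidean norm of vectors and the corresponding operator norm of matrices, and let $\|A\|_M=\max_{i,j}|a_{ij}|$ for a matrix $A=[a_{ij}]$. Assume that there exist a (non-random) sequence of invertible symmetric real $p\times p$ matrices $V_n$ and a (non-random) sequence of parameter values $\theta_n^*\in\mathbb R^p$ such that: (G1) $\|V_n^{-1}\|\to 0$ as $n\to\infty$. (G2) There exists $l>0$ such that $P(l_n<l)\to 0$ as $n\to\infty$, where $l_n=\inf_{\|\phi\|=1}\phi^\top V_n^{-1}J_n(\theta_n^*)V_n^{-1}\phi$. (G3) For every $d>0$, $\gamma_{nd}=\sup_{\|V_n(\theta-\theta_n^*)\|\le d}\bigl\|V_n^{-1}\{J_n(\theta)-J_n(\theta_n^*)\}V_n^{-1}\bigr\|_M\to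 0$ in probability under $P$ as $n\to\infty$. (G4) The sequence $V_n^{-1}u_n(\theta_n^*)$ is bounded in probability: for each $\epsilon>0$ there exists $d$ such that $P(\|V_n^{-1}u_n(\theta_n^*)\|>d)\le\epsilon$ for all sufficiently large $n$. Then for each $\epsilon>0$ there exists $d>0$ such that, for all sufficiently large $n$, $$P\bigl\{\exists\,\tilde\theta_n\in\mathbb R^p:\ u_n(\tilde\theta_n)=0\ \text{ and }\ \|V_n(\tilde\theta_n-\theta_n^*)\|<d\bigr\}>1-\epsilon .$$ -/

import Mathlib

open MeasureTheory Filter Topology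

noncomputable section

/-- The entrywise maximum norm `max_{i,j} |a_{ij}|` of a square real matrix. -/
def matrixMaxNorm {p : ℕ} (A : Matrix (Fin p) (Fin p) ℝ) : ℝ :=
  ⨆ ij : Fin p × Fin p, |A ij.1 ij.2|

/-- The matrix-vector product `A x` on Euclidean space `ℝ^p`. -/
def matVec {p : ℕ} (A : Matrix (Fin p) (Fin p) ℝ) (x : EuclideanSpace ℝ (Fin p)) :
    EuclideanSpace ℝ (Fin p) :=
  Matrix.toEuclideanCLM (𝕜 := ℝ) A x

/-- The matrix `J(θ) = - d f / d θ`, with entries `- ∂ f_i / ∂ θ_j`. -/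
def negJacobian {p : ℕ} (f : EuclideanSpace ℝ (Fin p) → EuclideanSpace ℝ (Fin p))
    (θ : EuclideanSpace ℝ (Fin p)) : Matrix (Fin p) (Fin p) ℝ :=
  Matrix.of fun i j => -(fderiv ℝ f θ (EuclideanSpace.single j 1)) i

/-- The infimum of `φᵀ V⁻¹ J(θ₀) V⁻¹ φ` over unit vectors `φ`, where `J = - d f / d θ`
(as an extended real, so that no convention on infima of real sets is involved). -/
def lowerForm {p : ℕ} (f : EuclideanSpace ℝ (Fin p) → EuclideanSpace ℝ (Fin p))
    (V : Matrix (Fin p) (Fin p) ℝ) (θ₀ : EuclideanSpace ℝ (Fin p)) : EReal :=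
  ⨅ φ ∈ Metric.sphere (0 : EuclideanSpace ℝ (Fin p)) 1,
    ((inner ℝ φ (matVec (V⁻¹ * negJacobian f θ₀ * V⁻¹) φ) : ℝ) : EReal)

/-- The supremum of `‖V⁻¹ (J(θ) - J(θ₀)) V⁻¹‖_M` over all `θ` with `‖V (θ - θ₀)‖ ≤ d`
(possibly infinite). -/
def jacobianOscillation {p : ℕ} (f : EuclideanSpace ℝ (Fin p) → EuclideanSpace ℝ (Fin p))
    (V : Matrix (Fin p) (Fin p) ℝ) (θ₀ : EuclideanSpace ℝ (Fin p)) (d : ℝ) : ENNReal :=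
  ⨆ θ ∈ {θ : EuclideanSpace ℝ (Fin p) | ‖matVec V (θ - θ₀)‖ ≤ d},
    ENNReal.ofReal (matrixMaxNorm (V⁻¹ * (negJacobian f θ - negJacobian f θ₀) * V⁻¹))

end

/-!
In the local coordinate `x = V (θ - θ₀)` the equation `f θ = 0` becomes `g x = 0`, where
`g x = -V⁻¹ f (θ₀ + V⁻¹ x)` has derivative `V⁻¹ J(θ) V⁻¹`. Outside three events of small
probability, this derivative is coercive at `x = 0` and hence invertible with inverse bounded by
`1 / l`, it differs from its value at `0` by at most `l / 2` on a fixed ball, and `g 0` is bounded.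
The quantitative inverse function theorem then says that the image of the ball under `g` contains a
ball around `g 0` large enough to contain `0`.
-/

open scoped NNReal

section CoerciveDerivative

theorem exists_nonlinearRightInverse_of_forall_le_norm_inner_map {𝕜 E : Type*} [RCLike 𝕜]
    [NormedAddCommGroup E] [InnerProductSpace 𝕜 E] [CompleteSpace E] (A : E →L[𝕜] E) {c : ℝ≥0}
    (hc : 0 < c) (hA : ∀ x, ‖x‖ ^ 2 * c ≤ ‖inner 𝕜 (A x) x‖) :
    ∃ B : A.NonlinearRightInverse, B.nnnorm = c⁻¹ := by
  have hanti : AntilipschitzWith c⁻¹ A := A.antilipschitz_of_forall_le_inner_map hc hA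
  have hbij : Function.Bijective A :=
    ContinuousLinearMap.isUnit_iff_bijective.1 (A.isUnit_of_forall_le_norm_inner_map hc hA)
  obtain ⟨B, hB⟩ := hbij.surjective.hasRightInverse
  refine ⟨⟨B, c⁻¹, fun y => ?_, hB⟩, rfl⟩
  simpa only [hB y] using hanti.le_mul_norm (map_zero A) (B y)

theorem approximatesLinearOn_of_norm_hasFDerivWithinAt_sub_le {𝕜 E F : Type*} [RCLike 𝕜]
    [NormedAddCommGroup E] [NormedSpace ℝ E] [NormedSpace 𝕜 E]
    [NormedAddCommGroup F] [NormedSpace 𝕜 F]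
    {f : E → F} {f' : E → E →L[𝕜] F} {A : E →L[𝕜] F} {s : Set E} {c : ℝ≥0} (hs : Convex ℝ s)
    (hf : ∀ x ∈ s, HasFDerivWithinAt f (f' x) s x) (hf' : ∀ x ∈ s, ‖f' x - A‖ ≤ c) :
    ApproximatesLinearOn f A s c :=
  fun _x hx _y hy => hs.norm_image_sub_le_of_norm_hasFDerivWithin_le' hf hf' hy hx

variable {E : Type*} [NormedAddCommGroup E] [InnerProductSpace ℝ E] [CompleteSpace E]

theorem exists_zero_mem_closedBall_of_coercive {f : E → E} {f' : E → E →L[ℝ] E} {A : E →L[ℝ] E}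
    {x₀ : E} {r l c : ℝ} (hr : 0 ≤ r) (hl : 0 < l)
    (hf : ∀ x ∈ Metric.closedBall x₀ r, HasFDerivWithinAt f (f' x) (Metric.closedBall x₀ r) x)
    (hA : ∀ x, l * ‖x‖ ^ 2 ≤ inner ℝ x (A x))
    (hf' : ∀ x ∈ Metric.closedBall x₀ r, ‖f' x - A‖ ≤ c) (hx₀ : ‖f x₀‖ ≤ (l - c) * r) :
    ∃ x ∈ Metric.closedBall x₀ r, f x = 0 := by
  have hc : 0 ≤ c := (norm_nonneg _).trans (hf' x₀ (Metric.mem_closedBall_self hr))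
  lift l to ℝ≥0 using hl.le
  lift c to ℝ≥0 using hc
  obtain ⟨B, hB⟩ := exists_nonlinearRightInverse_of_forall_le_norm_inner_map A
    (NNReal.coe_pos.1 hl) fun x => by
      rw [mul_comm, real_inner_comm]
      exact (hA x).trans (le_abs_self _)
  have happrox : ApproximatesLinearOn f A (Metric.closedBall x₀ r) c :=
    approximatesLinearOn_of_norm_hasFDerivWithinAt_sub_le (convex_closedBall x₀ r) hf hf'
  have hsurj := happrox.surjOn_closedBall_of_nonlinearRightInverse B hr subset_rfl
  rw [hB, NNReal.coe_inv, inv_inv] at hsurj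
  exact hsurj (by simpa using hx₀)

end CoerciveDerivative

section MatrixNorm

open scoped Matrix.Norms.Elementwise

theorem norm_toEuclideanCLM_le_card_mul_norm {ι 𝕜 : Type*} [Fintype ι] [DecidableEq ι] [RCLike 𝕜]
    (A : Matrix ι ι 𝕜) : ‖Matrix.toEuclideanCLM (𝕜 := 𝕜) A‖ ≤ Fintype.card ι * ‖A‖ := by
  refine ContinuousLinearMap.opNorm_le_bound _ (by positivity) fun x => ?_
  have hcoord (i : ι) : ‖Matrix.toEuclideanCLM (𝕜 := 𝕜) A x i‖ ≤ ‖A‖ * ∑ j, ‖x j‖ :=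
    calc ‖∑ j, A i j * x j‖ ≤ ∑ j, ‖A i j‖ * ‖x j‖ := by
          simpa only [norm_mul] using norm_sum_le Finset.univ fun j => A i j * x j
      _ ≤ ‖A‖ * ∑ j, ‖x j‖ := by
          rw [Finset.mul_sum]
          gcongr with j
          exact A.norm_entry_le_entrywise_sup_norm
  refine le_of_sq_le_sq ?_ (by positivity)
  calc ‖Matrix.toEuclideanCLM (𝕜 := 𝕜) A x‖ ^ 2
      = ∑ i, ‖Matrix.toEuclideanCLM (𝕜 := 𝕜) A x i‖ ^ 2 := EuclideanSpace.norm_sq_eq _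
    _ ≤ ∑ _i : ι, (‖A‖ * ∑ j, ‖x j‖) ^ 2 := by
        gcongr with i
        exact hcoord i
    _ = Fintype.card ι * ‖A‖ ^ 2 * (∑ j, ‖x j‖) ^ 2 := by
        rw [Finset.sum_const, Finset.card_univ, nsmul_eq_mul]
        ring
    _ ≤ Fintype.card ι * ‖A‖ ^ 2 * (Fintype.card ι * ∑ j, ‖x j‖ ^ 2) := by
        gcongr
        exact sq_sum_le_card_mul_sum_sq
    _ = (Fintype.card ι * ‖A‖ * ‖x‖) ^ 2 := by
        rw [← EuclideanSpace.norm_sq_eq]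
        ring

theorem norm_eq_matrixMaxNorm {p : ℕ} (A : Matrix (Fin p) (Fin p) ℝ) : ‖A‖ = matrixMaxNorm A :=
  le_antisymm
    ((Matrix.norm_le_iff (Real.iSup_nonneg fun _ => abs_nonneg _)).2 fun i j =>
      le_ciSup (f := fun ij : Fin p × Fin p => |A ij.1 ij.2|) (Set.finite_range _).bddAbove (i, j))
    (Real.iSup_le (fun _ => A.norm_entry_le_entrywise_sup_norm) (norm_nonneg A))

theorem norm_toEuclideanCLM_le_mul_matrixMaxNorm {p : ℕ} (A : Matrix (Fin p) (Fin p) ℝ) :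
    ‖Matrix.toEuclideanCLM (𝕜 := ℝ) A‖ ≤ p * matrixMaxNorm A := by
  simpa only [Fintype.card_fin, norm_eq_matrixMaxNorm] using norm_toEuclideanCLM_le_card_mul_norm A

end MatrixNorm

section LocalCoordinates

variable {p : ℕ} {f : EuclideanSpace ℝ (Fin p) → EuclideanSpace ℝ (Fin p)}
  {V : Matrix (Fin p) (Fin p) ℝ} {θ θ₀ : EuclideanSpace ℝ (Fin p)} {l r δ : ℝ}

/-- The normalised Jacobian `V⁻¹ J(θ) V⁻¹`, as a linear operator on Euclidean space. -/
noncomputable def normalizedJacobian (f : EuclideanSpace ℝ (Fin p) → EuclideanSpace ℝ (Fin p))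
    (V : Matrix (Fin p) (Fin p) ℝ) (θ : EuclideanSpace ℝ (Fin p)) :
    EuclideanSpace ℝ (Fin p) →L[ℝ] EuclideanSpace ℝ (Fin p) :=
  Matrix.toEuclideanCLM (𝕜 := ℝ) (V⁻¹ * negJacobian f θ * V⁻¹)

/-- The estimating function `f` in the local coordinate `x = V (θ - θ₀)`, normalised by `V⁻¹`. The
sign is chosen so that its derivative is `V⁻¹ J(θ) V⁻¹` rather than the negative of it. -/
noncomputable def localEstimatingMap (f : EuclideanSpace ℝ (Fin p) → EuclideanSpace ℝ (Fin p))
    (V : Matrix (Fin p) (Fin p) ℝ) (θ₀ x : EuclideanSpace ℝ (Fin p)) : EuclideanSpace ℝ (Fin p) :=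
  -matVec V⁻¹ (f (θ₀ + matVec V⁻¹ x))

theorem matVec_matVec_inv (hV : IsUnit V) (x : EuclideanSpace ℝ (Fin p)) :
    matVec V (matVec V⁻¹ x) = x := by
  have h := congrArg (Matrix.toEuclideanCLM (𝕜 := ℝ))
    (V.mul_nonsing_inv ((Matrix.isUnit_iff_isUnit_det V).1 hV))
  rw [map_mul, map_one] at h
  exact DFunLike.congr_fun h x

theorem eq_zero_of_localEstimatingMap_eq_zero (hV : IsUnit V) {x : EuclideanSpace ℝ (Fin p)}
    (hx : localEstimatingMap f V θ₀ x = 0) : f (θ₀ + matVec V⁻¹ x) = 0 := by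
  have h : matVec V⁻¹ (f (θ₀ + matVec V⁻¹ x)) = 0 := neg_eq_zero.1 hx
  rw [← matVec_matVec_inv hV (f _), h, matVec, map_zero]

theorem toEuclideanCLM_negJacobian (f : EuclideanSpace ℝ (Fin p) → EuclideanSpace ℝ (Fin p))
    (θ : EuclideanSpace ℝ (Fin p)) :
    Matrix.toEuclideanCLM (𝕜 := ℝ) (negJacobian f θ) = -fderiv ℝ f θ := by
  refine ContinuousLinearMap.coe_injective <|
    (EuclideanSpace.basisFun (Fin p) ℝ).toBasis.ext fun j => ?_
  ext i
  simp [negJacobian, Matrix.mulVec_single]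

theorem hasFDerivAt_localEstimatingMap {x : EuclideanSpace ℝ (Fin p)}
    (hf : DifferentiableAt ℝ f (θ₀ + matVec V⁻¹ x)) :
    HasFDerivAt (localEstimatingMap f V θ₀) (normalizedJacobian f V (θ₀ + matVec V⁻¹ x)) x := by
  set W := Matrix.toEuclideanCLM (𝕜 := ℝ) V⁻¹ with hW
  have hJ : normalizedJacobian f V (θ₀ + W x) = -(W ∘L fderiv ℝ f (θ₀ + W x) ∘L W) := by
    rw [normalizedJacobian, map_mul, map_mul, toEuclideanCLM_negJacobian, ← hW]
    ext
    simp
  exact hJ ▸ (W.hasFDerivAt.comp x (hf.hasFDerivAt.comp x (W.hasFDerivAt.const_add θ₀))).neg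

theorem mul_norm_sq_le_inner_normalizedJacobian (h : (l : EReal) ≤ lowerForm f V θ₀)
    (x : EuclideanSpace ℝ (Fin p)) : l * ‖x‖ ^ 2 ≤ inner ℝ x (normalizedJacobian f V θ₀ x) := by
  rcases eq_or_ne x 0 with rfl | hx
  · simp
  have hnorm : ‖x‖ ≠ 0 := norm_ne_zero_iff.2 hx
  have hunit : ‖x‖⁻¹ • x ∈ Metric.sphere (0 : EuclideanSpace ℝ (Fin p)) 1 := by
    simp [norm_smul, hnorm]
  have hl : l ≤ inner ℝ (‖x‖⁻¹ • x) (normalizedJacobian f V θ₀ (‖x‖⁻¹ • x)) :=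
    EReal.coe_le_coe_iff.1 (h.trans (iInf₂_le _ hunit))
  rw [map_smul, real_inner_smul_left, real_inner_smul_right] at hl
  calc l * ‖x‖ ^ 2
      ≤ ‖x‖⁻¹ * (‖x‖⁻¹ * inner ℝ x (normalizedJacobian f V θ₀ x)) * ‖x‖ ^ 2 := by gcongr
    _ = inner ℝ x (normalizedJacobian f V θ₀ x) := by field_simp

theorem norm_normalizedJacobian_sub_le (hδ : 0 ≤ δ)
    (hosc : jacobianOscillation f V θ₀ r ≤ ENNReal.ofReal δ) (hθ : ‖matVec V (θ - θ₀)‖ ≤ r) :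
    ‖normalizedJacobian f V θ - normalizedJacobian f V θ₀‖ ≤ p * δ := by
  have hmax : matrixMaxNorm (V⁻¹ * (negJacobian f θ - negJacobian f θ₀) * V⁻¹) ≤ δ :=
    (ENNReal.ofReal_le_ofReal_iff hδ).1 (iSup₂_le_iff.1 hosc θ hθ)
  rw [normalizedJacobian, normalizedJacobian, ← map_sub, ← sub_mul, ← mul_sub]
  exact (norm_toEuclideanCLM_le_mul_matrixMaxNorm _).trans (by gcongr)

theorem exists_zero_of_jacobianOscillation_le (hf : Differentiable ℝ f) (hV : IsUnit V)
    (hl : 0 < l) (hr : 0 ≤ r) (hδ : 0 ≤ δ) (hlower : (l : EReal) ≤ lowerForm f V θ₀)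
    (hosc : jacobianOscillation f V θ₀ r ≤ ENNReal.ofReal δ)
    (hval : ‖matVec V⁻¹ (f θ₀)‖ ≤ (l - p * δ) * r) :
    ∃ θ, f θ = 0 ∧ ‖matVec V (θ - θ₀)‖ ≤ r := by
  have hcoord (x : EuclideanSpace ℝ (Fin p)) (hx : x ∈ Metric.closedBall 0 r) :
      ‖matVec V (θ₀ + matVec V⁻¹ x - θ₀)‖ ≤ r := by
    rwa [add_sub_cancel_left, matVec_matVec_inv hV, ← mem_closedBall_zero_iff]
  have hval₀ : ‖localEstimatingMap f V θ₀ 0‖ ≤ (l - p * δ) * r := by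
    rwa [localEstimatingMap, norm_neg, show matVec V⁻¹ 0 = 0 from map_zero _, add_zero]
  obtain ⟨x, hx, hx₀⟩ := exists_zero_mem_closedBall_of_coercive hr hl
    (fun x _ => (hasFDerivAt_localEstimatingMap (hf _)).hasFDerivWithinAt)
    (mul_norm_sq_le_inner_normalizedJacobian hlower)
    (fun x hx => norm_normalizedJacobian_sub_le hδ hosc (hcoord x hx)) hval₀
  exact ⟨θ₀ + matVec V⁻¹ x, eq_zero_of_localEstimatingMap_eq_zero hV hx₀, hcoord x hx⟩

end LocalCoordinates

section Probability

theorem one_sub_sum_measureReal_le {Ω ι : Type*} [MeasurableSpace Ω] [Fintype ι] (P : Measure Ω)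
    [IsProbabilityMeasure P] {good : Set Ω} {bad : ι → Set Ω}
    (h : ∀ ω, (∀ i, ω ∉ bad i) → ω ∈ good) : 1 - ∑ i, P.real (bad i) ≤ P.real good := by
  have hcover : Set.univ ⊆ good ∪ ⋃ i, bad i := fun ω _ => by
    by_contra hω
    simp only [Set.mem_union, Set.mem_iUnion, not_or, not_exists] at hω
    exact hω.1 (h ω hω.2)
  rw [sub_le_iff_le_add]
  calc 1 = P.real Set.univ := probReal_univ.symm
    _ ≤ P.real (good ∪ ⋃ i, bad i) := measureReal_mono hcover
    _ ≤ P.real good + P.real (⋃ i, bad i) := measureReal_union_le _ _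
    _ ≤ P.real good + ∑ i, P.real (bad i) := by
        gcongr
        exact measureReal_iUnion_fintype_le _

theorem eventually_measureReal_lt {ι : Type*} {L : Filter ι} {Ω : ι → Type*}
    [∀ i, MeasurableSpace (Ω i)] {P : ∀ i, Measure (Ω i)} {s : ∀ i, Set (Ω i)} {ε : ℝ}
    (h : Tendsto (fun i => P i (s i)) L (𝓝 0)) (hε : 0 < ε) : ∀ᶠ i in L, (P i).real (s i) < ε :=
  ((ENNReal.tendsto_toReal ENNReal.zero_ne_top).comp h).eventually_lt_const hε

end Probability

theorem mainTheorem4_general {ι : Type*} {L : Filter ι} {Ω : ι → Type*}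
    [∀ n, MeasurableSpace (Ω n)] (P : ∀ n, Measure (Ω n)) [∀ n, IsProbabilityMeasure (P n)]
    {p : ℕ} (u : ∀ n, Ω n → EuclideanSpace ℝ (Fin p) → EuclideanSpace ℝ (Fin p))
    (hu_diff : ∀ n ω, Differentiable ℝ (u n ω))
    (V : ι → Matrix (Fin p) (Fin p) ℝ) (hV_inv : ∀ n, IsUnit (V n))
    (θs : ι → EuclideanSpace ℝ (Fin p))
    (G2 : ∃ l : ℝ, 0 < l ∧
      Tendsto (fun n => P n {ω | lowerForm (u n ω) (V n) (θs n) < (l : EReal)}) L (𝓝 0))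
    (G3 : ∀ d : ℝ, 0 < d → ∀ δ : ℝ, 0 < δ →
      Tendsto (fun n => P n {ω | ENNReal.ofReal δ < jacobianOscillation (u n ω) (V n) (θs n) d})
        L (𝓝 0))
    (G4 : ∀ ε : ℝ, 0 < ε → ∃ d : ℝ, ∀ᶠ n in L,
      (P n).real {ω | d < ‖matVec (V n)⁻¹ (u n ω (θs n))‖} ≤ ε)
    (ε : ℝ) (hε : 0 < ε) :
    ∃ d : ℝ, 0 < d ∧ ∀ᶠ n in L,
      1 - ε < (P n).real {ω | ∃ θ : EuclideanSpace ℝ (Fin p),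
        u n ω θ = 0 ∧ ‖matVec (V n) (θ - θs n)‖ < d} := by
  obtain ⟨l, hl, hlower⟩ := G2
  obtain ⟨b, hval⟩ := G4 (ε / 3) (by positivity)
  obtain ⟨r, hr, hbr⟩ : ∃ r, 0 < r ∧ b ≤ l / 2 * r :=
    ⟨2 / l * max b 1, by positivity, by field_simp; exact le_max_left b 1⟩
  obtain ⟨δ, hδ, hpδ⟩ : ∃ δ, 0 < δ ∧ p * δ < l / 2 := exists_pos_mul_lt (half_pos hl) _
  refine ⟨r + 1, by positivity, ?_⟩
  filter_upwards [eventually_measureReal_lt hlower (show 0 < ε / 3 by positivity),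
    eventually_measureReal_lt (G3 r hr δ hδ) (show 0 < ε / 3 by positivity), hval]
    with n hn_lower hn_osc hn_val
  refine lt_of_lt_of_le ?_ (one_sub_sum_measureReal_le (P n) (bad := ![
    {ω | lowerForm (u n ω) (V n) (θs n) < (l : EReal)},
    {ω | ENNReal.ofReal δ < jacobianOscillation (u n ω) (V n) (θs n) r},
    {ω | b < ‖matVec (V n)⁻¹ (u n ω (θs n))‖}]) fun ω hω => ?_)
  · simp only [Fin.sum_univ_three, Matrix.cons_val]
    linarith
  · have hbound : b ≤ (l - p * δ) * r := hbr.trans (by gcongr; linarith)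
    obtain ⟨θ, hθ, hθr⟩ := exists_zero_of_jacobianOscillation_le (hu_diff n ω) (hV_inv n) hl
      hr.le hδ.le (not_lt.1 (hω 0)) (not_lt.1 (hω 1)) ((not_lt.1 (hω 2)).trans hbound)
    exact ⟨θ, hθ, by linarith⟩

theorem mainTheorem4 {Ω : Type*} [MeasurableSpace Ω] (P : Measure Ω) [IsProbabilityMeasure P]
    {p : ℕ}
    -- the estimating functions: random functions `ℝ^p → ℝ^p`, differentiable in the parameter
    (u : ℕ → Ω → EuclideanSpace ℝ (Fin p) → EuclideanSpace ℝ (Fin p))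
    (hu_meas : ∀ n θ, Measurable fun ω => u n ω θ)
    (hu_diff : ∀ n ω, Differentiable ℝ (u n ω))
    -- the normalising matrices and the parameter values
    (V : ℕ → Matrix (Fin p) (Fin p) ℝ)
    (hV_symm : ∀ n, (V n).IsSymm)
    (hV_inv : ∀ n, IsUnit (V n))
    (θs : ℕ → EuclideanSpace ℝ (Fin p))
    (G1 : Tendsto (fun n => ‖Matrix.toEuclideanCLM (𝕜 := ℝ) (V n)⁻¹‖) atTop (𝓝 0))
    (G2 : ∃ l : ℝ, 0 < l ∧
      Tendsto (fun n => P {ω | lowerForm (u n ω) (V n) (θs n) < (l : EReal)}) atTop (𝓝 0))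
    (G3 : ∀ d : ℝ, 0 < d → ∀ δ : ℝ, 0 < δ →
      Tendsto (fun n => P {ω | ENNReal.ofReal δ < jacobianOscillation (u n ω) (V n) (θs n) d})
        atTop (𝓝 0))
    (G4 : ∀ ε : ℝ, 0 < ε → ∃ d : ℝ, ∀ᶠ n in atTop,
      P.real {ω | d < ‖matVec (V n)⁻¹ (u n ω (θs n))‖} ≤ ε) :
    ∀ ε : ℝ, 0 < ε → ∃ d : ℝ, 0 < d ∧ ∀ᶠ n in atTop,
      1 - ε < P.real {ω | ∃ θ : EuclideanSpace ℝ (Fin p),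
        u n ω θ = 0 ∧ ‖matVec (V n) (θ - θs n)‖ < d} :=
  mainTheorem4_general (fun _ => P) u hu_diff V hV_inv θs G2 G3 G4
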